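/- Let $R$ be any commutative ring and $t,w,v,x\in R$ (for instance $R=\mathbb Z[t,w,v,x]$ with $t,w,v,x$ indeterminates). Then the following identity of formal power series in $R[[q]]$ holds, where the infinite sum and the infinite product converge coefficientwise: $$ \begin{aligned} 1&+q^2\frac{t+wq}{1-tq^2}+ q^6\frac{w^2+vq+xq^2}{(1-tq^2)(1-wq^3)}+ q^{12}\frac{1+q+v^2q^2+xvq^3+x^2q^4+q^5+q^6}{(1-tq^2)(1-wq^3)(1-vq^7)}\\ &+q^{20}\frac{x+xq+q^2+q^3+(1+x^3)q^4+(1+x)q^5+(1+x)q^6+q^7+q^8+q^9+q^{10}} {(1-tq^2)(1-wq^3)(1-xq^8)(1-vq^7)}\\ &+q^{30}\frac{(1+q+q^2+q^3+q^4+q^5+q^6)(1+q^4)} {(1-tq^2)(1-wq^3)(1-xq^8)(1-q^5)(1-vq^7)}\\ &+q^{42}\frac{(1+q+q^2+q^3+q^4+q^5+q^6)(1+q^4)} {(1-tq^2)(1-wq^3)(1-xq^8)(1-q^5)(1-q^6)(1-vq^7)}\\ &+q^{56}\frac{1+q^4} {(1-q)(1-tq^2)(1-wq^3)(1-xq^8)(1-q^5)(1-q^6)(1-vq^7)}\\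 &+\sum_{m=8}^\infty \frac{q^{m(m+1)}}{\prod_{k=1}^m(1-a_kq^k)} =\prod_{\substack{k\ge 1\\ k\equiv 2,3 \,(\mathrm{mod}\ 5)}}\frac{1}{1-a_kq^k}, \end{aligned} $$ where $a_2=t$, $a_3=w$, $a_7=v$, $a_8=x$ and $a_k=1$ for all other $k$. Moreover, when $t,w,v,x$ are indeterminates over $\mathbb Z$, all the displayed numerators are polynomials in $q,t,w,v,x$ with non-negative integer coefficients. -/

import Mathlib

namespace RogersRamanujan

/-- The weight of a part of size `k`: parts of size `2, 3, 7, 8` have weights `t, w, v, x`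
respectively, and all other parts have weight `1`. -/
def weight {R : Type*} [CommRing R] (t w v x : R) (k : ℕ) : R :=
  if k = 2 then t else if k = 3 then w else if k = 7 then v else if k = 8 then x else 1

/-- The power series `1 - a_k q^k`, with `a_k` the weight of the part size `k`;
the power series variable is `q`. -/
noncomputable def factor {R : Type*} [CommRing R] (t w v x : R) (k : ℕ) : PowerSeries R :=
  1 - PowerSeries.C (weight t w v x k) * PowerSeries.X ^ k

/-- The multiplicative inverse of a power series whose constant term is `1`. -/
noncomputable def recip {R : Type*} [CommRing R] (f : PowerSeries R) : PowerSeries R :=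
  PowerSeries.invOfUnit f 1

theorem mul_recip {R : Type*} [CommRing R] (f : PowerSeries R)
    (hf : PowerSeries.constantCoeff f = 1) : f * recip f = 1 :=
  PowerSeries.mul_invOfUnit f 1 (by simpa using hf)

theorem constantCoeff_factor {R : Type*} [CommRing R] (t w v x : R) {k : ℕ} (hk : k ≠ 0) :
    PowerSeries.constantCoeff (factor t w v x k) = 1 := by
  simp [factor, hk]

section Numerator
open Polynomial

/-- The numerator polynomial (in the variable `q`, without the power `q^(m(m+1))`) of the
`m`-th term of the sum side. -/
noncomputable def numerator {R : Type*} [CommRing R] (t w v x : R) : ℕ → Polynomial R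
  | 0 => 1
  | 1 => C t + C w * X
  | 2 => C (w ^ 2) + C v * X + C x * X ^ 2
  | 3 => 1 + X + C (v ^ 2) * X ^ 2 + C (x * v) * X ^ 3 + C (x ^ 2) * X ^ 4 + X ^ 5 + X ^ 6
  | 4 => C x + C x * X + X ^ 2 + X ^ 3 + C (1 + x ^ 3) * X ^ 4 + C (1 + x) * X ^ 5
      + C (1 + x) * X ^ 6 + X ^ 7 + X ^ 8 + X ^ 9 + X ^ 10
  | 5 => (1 + X + X ^ 2 + X ^ 3 + X ^ 4 + X ^ 5 + X ^ 6) * (1 + X ^ 4)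
  | 6 => (1 + X + X ^ 2 + X ^ 3 + X ^ 4 + X ^ 5 + X ^ 6) * (1 + X ^ 4)
  | 7 => 1 + X ^ 4
  | _ + 8 => 1

end Numerator

/-- The set of part sizes `k` for which the factor `1 - a_k q^k` occurs in the denominator of
the `m`-th term of the sum side. -/
def denominatorParts : ℕ → Finset ℕ
  | 0 => ∅
  | 1 => {2}
  | 2 => {2, 3}
  | 3 => {2, 3, 7}
  | 4 => {2, 3, 8, 7}
  | 5 => {2, 3, 8, 5, 7}
  | 6 => {2, 3, 8, 5, 6, 7}
  | 7 => {1, 2, 3, 8, 5, 6, 7}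
  | m + 8 => Finset.Icc 1 (m + 8)

/-- The denominator of the `m`-th term of the sum side. -/
noncomputable def denominator {R : Type*} [CommRing R] (t w v x : R) (m : ℕ) : PowerSeries R :=
  ∏ k ∈ denominatorParts m, factor t w v x k

theorem constantCoeff_denominator {R : Type*} [CommRing R] (t w v x : R) (m : ℕ) :
    PowerSeries.constantCoeff (denominator t w v x m) = 1 := by
  rw [denominator, map_prod]
  refine Finset.prod_eq_one fun k hk => constantCoeff_factor t w v x ?_
  rintro rfl
  revert hk
  unfold denominatorParts
  split <;> simp

/-- The `m`-th term of the sum side: `q^(m(m+1))` times the numerator over the denominator. -/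
noncomputable def sumTerm {R : Type*} [CommRing R] (t w v x : R) (m : ℕ) : PowerSeries R :=
  PowerSeries.X ^ (m * (m + 1)) * (numerator t w v x m : PowerSeries R)
    * recip (denominator t w v x m)

/-- The part sizes congruent to `2` or `3` modulo `5`. -/
abbrev Part23 : Type := {k : ℕ // k % 5 = 2 ∨ k % 5 = 3}

end RogersRamanujan

open scoped PowerSeries.WithPiTopology

/-! The identity is a weighted rearrangement of the second Rogers–Ramanujan identity, `∑
q^(n²+n)/(q;q)_n = ∏ 1/(1-q^k)` over `k ≡ 2, 3 (mod 5)`. Multiplying that identity by `∏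
(1-q^k)/(1-a_k q^k)` over `k = 2, 3, 7, 8` (`weightRatio`) gives the weighted product. On the sum
side the terms with `m ≥ 5` become the displayed ones individually. The first five do not; only
their sums agree, a polynomial identity once denominators are cleared (`sum_sumTerm_range_five`).

The unweighted identity passes through a theta series. Sum side and theta side are embedded in
families indexed by `k`, both satisfying `D_k = D_(k+1) + q^(k+2) D_(k+2)`: the former termwise, the
latter by telescoping (`thetaSideTerm_sub`). After multiplication by `(q;q)_∞` the sum side agrees
with the theta side modulo `q^k`, so `eq_zero_of_recurrence` makes them equal. The theta series at
`k = 0` is the product of the `1-q^j` with `j ≡ 0, 1, 4 (mod 5)`, as the limit of a finite Jacobi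
triple product obtained from the `q`-binomial theorem. -/

namespace RogersRamanujan
open PowerSeries Filter Topology Finset

/-! ### Gaussian binomials and the `q`-binomial theorem -/

section GaussBinom
variable {R : Type*} [CommRing R]

/-- The finite product `(1 - Q) (1 - Q ^ 2) ⋯ (1 - Q ^ n)`. -/
def qFactorial (Q : R) (n : ℕ) : R := ∏ i ∈ range n, (1 - Q ^ (i + 1))

/-- The Gaussian binomial coefficients, defined by the `q`-Pascal recursion. -/
def gaussBinom (Q : R) : ℕ → ℕ → R
  | _, 0 => 1
  | 0, _ + 1 => 0
  | n + 1, k + 1 => gaussBinom Q n k + Q ^ (k + 1) * gaussBinom Q n (k + 1)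

theorem qFactorial_zero (Q : R) : qFactorial Q 0 = 1 := by simp [qFactorial]

theorem qFactorial_succ (Q : R) (n : ℕ) :
    qFactorial Q (n + 1) = qFactorial Q n * (1 - Q ^ (n + 1)) := prod_range_succ _ _

theorem gaussBinom_zero_right (Q : R) (n : ℕ) : gaussBinom Q n 0 = 1 := by
  cases n <;> rfl

theorem gaussBinom_succ_succ (Q : R) (n k : ℕ) : gaussBinom Q (n + 1) (k + 1) =
    gaussBinom Q n k + Q ^ (k + 1) * gaussBinom Q n (k + 1) := rfl

theorem gaussBinom_eq_zero_of_lt (Q : R) {n k : ℕ} (h : n < k) : gaussBinom Q n k = 0 := by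
  induction n generalizing k with
  | zero => obtain ⟨k, rfl⟩ := Nat.exists_eq_succ_of_ne_zero h.ne'; rfl
  | succ n ih =>
    obtain ⟨k, rfl⟩ := Nat.exists_eq_succ_of_ne_zero (Nat.ne_zero_of_lt h)
    rw [Nat.succ_eq_add_one, gaussBinom_succ_succ, ih (by omega), ih (by omega)]
    simp

theorem gaussBinom_self (Q : R) (n : ℕ) : gaussBinom Q n n = 1 := by
  induction n with
  | zero => rfl
  | succ n ih => rw [gaussBinom_succ_succ, ih, gaussBinom_eq_zero_of_lt Q n.lt_succ_self]; simp

/-- The Pascal recursion closes up because `(1 - Q^(k+1)) + Q^(k+1) (1 - Q^(m+1)) = 1 - Q^(m+k+2)`.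
The division-free form makes sense in every commutative ring. -/
theorem qFactorial_mul_gaussBinom (Q : R) (m k : ℕ) :
    qFactorial Q k * qFactorial Q m * gaussBinom Q (m + k) k = qFactorial Q (m + k) := by
  induction k generalizing m with
  | zero => simp [gaussBinom_zero_right, qFactorial_zero]
  | succ k ihk =>
    induction m with
    | zero => simp [gaussBinom_self, qFactorial_zero]
    | succ m ihm =>
      have h1 := ihk (m + 1)
      rw [show m + 1 + (k + 1) = (m + 1 + k) + 1 by ring, gaussBinom_succ_succ,
        qFactorial_succ Q (m + 1 + k)]
      rw [show m + 1 + k = m + (k + 1) by ring] at *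
      rw [qFactorial_succ Q m, qFactorial_succ Q k] at *
      linear_combination (1 - Q ^ (k + 1)) * h1 + Q ^ (k + 1) * (1 - Q ^ (m + 1)) * ihm

/-- The homogeneous `q`-binomial theorem. -/
theorem sum_gaussBinom (Q a x : R) (m : ℕ) :
    ∑ k ∈ range (m + 1), Q ^ (k.choose 2) * gaussBinom Q m k * x ^ k * a ^ (m - k) =
      ∏ i ∈ range m, (a + x * Q ^ i) := by
  induction m generalizing x with
  | zero => simp [gaussBinom_zero_right]
  | succ m ih =>
    rw [prod_range_succ']
    -- Removing the factor `i = 0` replaces `x` by `x * Q`, so the induction runs over all `x`.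
    have h : ∏ i ∈ range m, (a + x * Q ^ (i + 1)) = ∏ i ∈ range m, (a + (x * Q) * Q ^ i) :=
      prod_congr rfl fun i _ => by ring
    rw [h, ← ih, pow_zero, mul_one, mul_add, sum_mul, sum_mul, sum_range_succ']
    have e1 : ∑ k ∈ range (m + 1), Q ^ (k.choose 2) * gaussBinom Q m k * (x * Q) ^ k *
        a ^ (m - k) * a = a ^ (m + 1) + ∑ k ∈ range (m + 1), Q ^ ((k + 1).choose 2) *
          gaussBinom Q m (k + 1) * (x * Q) ^ (k + 1) * a ^ (m - k) := by
      rw [sum_range_succ', sum_range_succ _ m, gaussBinom_eq_zero_of_lt Q m.lt_succ_self,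
        add_comm (a ^ (m + 1))]
      simp only [Nat.choose_zero_succ, gaussBinom_zero_right, mul_zero, zero_mul, add_zero,
        pow_zero, one_mul, Nat.sub_zero, pow_succ a m]
      congr 1
      refine sum_congr rfl fun k hk => ?_
      rw [show m - k = m - (k + 1) + 1 by have := mem_range.1 hk; omega]
      ring
    rw [e1, add_assoc, ← sum_add_distrib, add_comm]
    congr 1
    · simp [gaussBinom_zero_right]
    · refine sum_congr rfl fun k _ => ?_
      rw [gaussBinom_succ_succ, Nat.add_sub_add_right, Nat.choose_succ_succ' k 1,
        Nat.choose_one_right]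
      ring

end GaussBinom

/-! ### Congruences modulo powers of `Q` -/

section Congruence
variable {R : Type*} [CommRing R]

theorem isUnit_of_constantCoeff_eq_one {f : R⟦X⟧} (h : constantCoeff f = 1) : IsUnit f :=
  isUnit_iff_constantCoeff.2 (h ▸ isUnit_one)

theorem constantCoeff_one_sub_X_pow {n : ℕ} (hn : n ≠ 0) :
    constantCoeff (1 - X ^ n : R⟦X⟧) = 1 := by simp [hn]

theorem constantCoeff_qFactorial {Q : R⟦X⟧} (hQ : constantCoeff Q = 0) (n : ℕ) :
    constantCoeff (qFactorial Q n) = 1 := by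
  simp [qFactorial, map_prod, hQ]

/-- The factors by which the two products differ are `1 - Q^j` with `j ≥ d`, hence `1` modulo `Q^d`.
-/
theorem pow_dvd_qFactorial_sub {S : Type*} [CommRing S] (Q : S) {d a b : ℕ} (ha : d ≤ a + 1)
    (hb : d ≤ b + 1) : Q ^ d ∣ qFactorial Q a - qFactorial Q b := by
  have key : ∀ c n, d ≤ c + 1 → Q ^ d ∣ qFactorial Q (c + n) - qFactorial Q c := by
    intro c n hc
    induction n with
    | zero => simp
    | succ n ih =>
      rw [← add_assoc, qFactorial_succ, mul_sub, mul_one, sub_right_comm]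
      exact dvd_sub ih ((pow_dvd_pow Q (by omega)).mul_left _)
  rcases le_total a b with h | h
  · obtain ⟨n, rfl⟩ := Nat.exists_eq_add_of_le h
    rw [← dvd_neg, neg_sub]
    exact key a n ha
  · obtain ⟨n, rfl⟩ := Nat.exists_eq_add_of_le h
    exact key b n hb

/-- `(Q; Q)_N [a + b, b]` tends to one. -/
theorem pow_dvd_qFactorial_mul_gaussBinom_sub_one {Q : R⟦X⟧} (hQ : constantCoeff Q = 0)
    {d N a b : ℕ} (hN : d ≤ N + 1) (ha : d ≤ a + 1) (hb : d ≤ b + 1) :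
    Q ^ d ∣ qFactorial Q N * gaussBinom Q (a + b) b - 1 := by
  have hu := isUnit_of_constantCoeff_eq_one (constantCoeff_qFactorial hQ a)
  rw [← hu.dvd_mul_left]
  have h1 := qFactorial_mul_gaussBinom Q a b
  have h2 : Q ^ d ∣ qFactorial Q N - qFactorial Q b := pow_dvd_qFactorial_sub Q hN hb
  have h3 : Q ^ d ∣ qFactorial Q (a + b) - qFactorial Q a :=
    pow_dvd_qFactorial_sub Q (by omega) ha
  have : qFactorial Q a * (qFactorial Q N * gaussBinom Q (a + b) b - 1) =
      (qFactorial Q N - qFactorial Q b) * (qFactorial Q a * gaussBinom Q (a + b) b) +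
        (qFactorial Q (a + b) - qFactorial Q a) := by
    linear_combination h1
  rw [this]
  exact dvd_add (h2.mul_right _) h3

theorem X_pow_add_dvd_X_pow_mul_iff {d n : ℕ} {f : R⟦X⟧} : X ^ (n + d) ∣ X ^ n * f ↔ X ^ d ∣ f := by
  refine ⟨fun ⟨g, hg⟩ => ⟨g, ?_⟩, fun ⟨g, hg⟩ => ⟨g, by rw [hg]; ring⟩⟩
  rw [pow_add, mul_assoc] at hg
  exact X_pow_mul_cancel hg

end Congruence

/-! ### The Jacobi triple product in base `q^5` -/

section TripleProduct
variable (R : Type*) [CommRing R]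

/-- The `n`-th term `(-1)^n q^(n(5n+3)/2) (1 - q^(2n+1))` of the theta series. -/
noncomputable def thetaTerm (n : ℕ) : R⟦X⟧ :=
  (-1) ^ n * X ^ (5 * n.choose 2 + 4 * n) * (1 - X ^ (2 * n + 1))

theorem two_mul_choose_two (n : ℕ) : 2 * n.choose 2 + n = n ^ 2 := by
  induction n with
  | zero => rfl
  | succ n ih => rw [Nat.choose_succ_succ' n 1, Nat.choose_one_right]; linarith

theorem choose_two_add (a b : ℕ) : (a + b).choose 2 = a.choose 2 + b.choose 2 + a * b := by
  have h1 := two_mul_choose_two (a + b)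
  have h2 := two_mul_choose_two a
  have h3 := two_mul_choose_two b
  nlinarith

/-- The pair `N - n`, `N + 1 + n` will yield the two monomials of `thetaTerm n`; the index `0` stays
unpaired. -/
theorem sum_range_two_mul_add_one {M : Type*} [AddCommMonoid M] (h : ℕ → M) (N : ℕ) :
    ∑ k ∈ range (2 * N + 1), h k =
      h 0 + ∑ n ∈ range N, (h (N - n) + h (N + 1 + n)) := by
  rw [show 2 * N + 1 = N + 1 + N by ring, sum_range_add, sum_range_succ', sum_add_distrib,
    ← sum_range_reflect, add_comm _ (h 0), add_assoc]
  congr 2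
  refine sum_congr rfl fun n hn => ?_
  have := mem_range.1 hn
  congr 1
  omega

variable {R}

/-- This is the `q`-binomial theorem with `Q = q^5`, `a = q^(5N)`, `x = -q` and `2N` factors. The
first `N` factors give the residue `4`, the last `N` the residue `1`. The homogeneous form with `a =
q^(5N)` avoids negative powers of `q`, at the price of a monomial prefactor. -/
theorem finite_triple_product (N : ℕ) :
    X ^ (N + 5 * N.choose 2 + 5 * N ^ 2) *
      ∏ i ∈ range N, ((1 - X ^ (5 * i + 1)) * (1 - X ^ (5 * i + 4)) : R⟦X⟧) =
    ∑ k ∈ range (2 * N + 1), (-1) ^ (N + k) * X ^ (5 * k.choose 2 + k + 5 * N * (2 * N - k)) *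
      gaussBinom (X ^ 5) (2 * N) k := by
  have h := sum_gaussBinom (X ^ 5 : R⟦X⟧) (X ^ (5 * N)) (-X) (2 * N)
  have h1 : ∏ i ∈ range N, (X ^ (5 * N) + -X * (X ^ 5) ^ i : R⟦X⟧) =
      (-1) ^ N * X ^ (N + 5 * N.choose 2) * ∏ i ∈ range N, (1 - X ^ (5 * i + 4)) := by
    have : ∀ i ∈ range N, (X ^ (5 * N) + -X * (X ^ 5) ^ i : R⟦X⟧) =
        -X * (X ^ 5) ^ i * (1 - X ^ (5 * (N - 1 - i) + 4)) := by
      intro i hi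
      obtain ⟨j, rfl⟩ : ∃ j, N = i + j + 1 := ⟨N - 1 - i, by have := mem_range.1 hi; omega⟩
      rw [show i + j + 1 - 1 - i = j by omega]
      ring
    rw [prod_congr rfl this, prod_mul_distrib, prod_mul_distrib,
      prod_range_reflect (fun i => (1 - X ^ (5 * i + 4) : R⟦X⟧)) N, prod_const, card_range,
      prod_pow_eq_pow_sum, sum_range_id, ← Nat.choose_two_right]
    ring
  have h2 : ∏ i ∈ range N, (X ^ (5 * N) + -X * (X ^ 5) ^ (N + i) : R⟦X⟧) =
      X ^ (5 * N ^ 2) * ∏ i ∈ range N, (1 - X ^ (5 * i + 1)) := by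
    have : ∀ i ∈ range N, (X ^ (5 * N) + -X * (X ^ 5) ^ (N + i) : R⟦X⟧) =
        X ^ (5 * N) * (1 - X ^ (5 * i + 1)) := fun i _ => by ring
    rw [prod_congr rfl this, prod_mul_distrib, prod_const, card_range]
    ring
  rw [two_mul N, prod_range_add, h1, h2, ← two_mul] at h
  have hs : ((-1) ^ N * (-1) ^ N : R⟦X⟧) = 1 := by rw [← mul_pow]; simp
  rw [prod_mul_distrib]
  calc _ = (-1) ^ N * ((-1) ^ N * X ^ (N + 5 * N.choose 2) *
        (∏ i ∈ range N, (1 - X ^ (5 * i + 4))) *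
        (X ^ (5 * N ^ 2) * ∏ i ∈ range N, (1 - X ^ (5 * i + 1)) : R⟦X⟧)) := by
        linear_combination (-(X ^ (N + 5 * N.choose 2) *
          (∏ i ∈ range N, (1 - X ^ (5 * i + 4))) *
          (X ^ (5 * N ^ 2) * ∏ i ∈ range N, (1 - X ^ (5 * i + 1)) : R⟦X⟧))) * hs
    _ = _ := by
      rw [← h, mul_sum]
      refine sum_congr rfl fun k _ => ?_
      rw [neg_pow X k]
      ring

/-- After multiplication by `(q^5;q^5)_N` each Gaussian binomial away from the ends is close to `1`,
so each pair in the finite identity approximates one theta term. -/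
theorem X_pow_dvd_triple_product_sub (N : ℕ) :
    X ^ N ∣ (∏ i ∈ range N, ((1 - X ^ (5 * i + 1)) * (1 - X ^ (5 * i + 4)) : R⟦X⟧)) *
      qFactorial (X ^ 5) N - ∑ n ∈ range N, thetaTerm R n := by
  set M := N + 5 * N.choose 2 + 5 * N ^ 2 with hM
  rw [← X_pow_add_dvd_X_pow_mul_iff (n := M), mul_sub, ← mul_assoc, finite_triple_product,
    sum_range_two_mul_add_one, add_mul, sum_mul, mul_sum, add_sub_assoc, ← sum_sub_distrib]
  have hQ : constantCoeff (X ^ 5 : R⟦X⟧) = 0 := by simp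
  refine dvd_add ?_ (dvd_sum fun n hn => ?_)
  -- The unpaired term carries the exponent `10 N²`, which is at least `M + N`.
  · refine Dvd.dvd.mul_right (Dvd.dvd.mul_right (Dvd.dvd.mul_left (pow_dvd_pow _ ?_) _) _) _
    have := two_mul_choose_two N
    simp only [Nat.choose_zero_succ, hM, Nat.sub_zero]
    nlinarith
  · have hn := mem_range.1 hn
    obtain ⟨k, rfl⟩ : ∃ k, N = n + 1 + k := ⟨N - (n + 1), by omega⟩
    have t := two_mul_choose_two n
    have g1 : (X : R⟦X⟧) ^ (5 * (k + 1)) ∣ qFactorial (X ^ 5) (n + 1 + k) *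
        gaussBinom (X ^ 5) (2 * (n + 1 + k)) (k + 1) - 1 := by
      have := pow_dvd_qFactorial_mul_gaussBinom_sub_one hQ (d := k + 1) (N := n + 1 + k)
        (a := 2 * n + 1 + k) (b := k + 1) (by omega) (by omega) (by omega)
      rwa [← pow_mul, show 2 * n + 1 + k + (k + 1) = 2 * (n + 1 + k) by ring] at this
    have g2 : (X : R⟦X⟧) ^ (5 * (k + 1)) ∣ qFactorial (X ^ 5) (n + 1 + k) *
        gaussBinom (X ^ 5) (2 * (n + 1 + k)) (2 * n + 2 + k) - 1 := by
      have := pow_dvd_qFactorial_mul_gaussBinom_sub_one hQ (d := k + 1) (N := n + 1 + k)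
        (a := k) (b := 2 * n + 2 + k) (by omega) (by omega) (by omega)
      rwa [← pow_mul, show k + (2 * n + 2 + k) = 2 * (n + 1 + k) by ring] at this
    have c1 := choose_two_add n (k + 1)
    rw [show n + (k + 1) = n + 1 + k by ring] at c1
    have c2 := choose_two_add (n + 1 + k) (n + 1)
    have c3 := choose_two_add n 1
    rw [show n + 1 + k + (n + 1) = n + 1 + k + 1 + n by ring] at c2
    rw [show n + 1 + k - n = k + 1 by omega,
      show 2 * (n + 1 + k) - (k + 1) = 2 * n + 1 + k by omega,
      show 2 * (n + 1 + k) - (n + 1 + k + 1 + n) = k by omega]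
    have x1 : 5 * (k + 1).choose 2 + (k + 1) + 5 * (n + 1 + k) * (2 * n + 1 + k) =
        M + (5 * n.choose 2 + 4 * n) := by
      simp only [hM]; nlinarith
    have x2 : 5 * (n + 1 + k + 1 + n).choose 2 + (n + 1 + k + 1 + n) + 5 * (n + 1 + k) * k =
        M + (5 * n.choose 2 + 4 * n) + (2 * n + 1) := by
      have : Nat.choose 1 2 = 0 := rfl
      simp only [hM]; nlinarith
    rw [x1, x2]
    have s1 : ((-1) ^ (n + 1 + k + (k + 1)) : R⟦X⟧) = (-1) ^ n := by
      rw [show n + 1 + k + (k + 1) = n + 2 * (k + 1) by ring, pow_add, pow_mul]; simp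
    have s2 : ((-1) ^ (n + 1 + k + (n + 1 + k + 1 + n)) : R⟦X⟧) = -(-1) ^ n := by
      rw [show n + 1 + k + (n + 1 + k + 1 + n) = (n + 1) + 2 * (n + k + 1) by ring, pow_add,
        pow_mul]
      simp [pow_succ]
    rw [s1, s2, thetaTerm, show n + 1 + k + 1 + n = 2 * n + 2 + k by ring]
    -- For `n` near `N` the binomials are only known modulo the small power `q^(5(k+1))`; the
    -- exponent of the theta term makes up the loss.
    have hle : M + (n + 1 + k) ≤ M + (5 * n.choose 2 + 4 * n) + 5 * (k + 1) := by omega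
    refine (pow_dvd_pow X hle).trans ?_
    rw [pow_add X _ (5 * (k + 1))]
    obtain ⟨u, hu⟩ := g1
    obtain ⟨u', hu'⟩ := g2
    refine ⟨(-1) ^ n * (u - X ^ (2 * n + 1) * u'), ?_⟩
    rw [pow_add X _ (2 * n + 1), pow_add X M]
    linear_combination ((-1) ^ n * X ^ M * X ^ (5 * n.choose 2 + 4 * n)) * hu -
      ((-1) ^ n * X ^ M * X ^ (5 * n.choose 2 + 4 * n) * X ^ (2 * n + 1)) * hu'

end TripleProduct

/-! ### Convergence from divisibility by powers of `X` -/

section Convergence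
variable {R : Type*} [CommRing R]

theorem eq_zero_of_forall_X_pow_dvd {f : R⟦X⟧} (h : ∀ d : ℕ, X ^ d ∣ f) : f = 0 := by
  ext n
  simpa using X_pow_dvd_iff.1 (h (n + 1)) n n.lt_succ_self

theorem order_le_of_X_pow_dvd {f : R⟦X⟧} {n : ℕ} (h : X ^ n ∣ f) : n ≤ f.order :=
  nat_le_order f n (X_pow_dvd_iff.1 h)

theorem tendsto_order_of_X_pow_dvd {f : ℕ → R⟦X⟧} (h : ∀ n, X ^ n ∣ f n) :
    Tendsto (fun n => (f n).order) atTop (𝓝 ⊤) := by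
  refine ENat.tendsto_nhds_top_iff_natCast_lt.mpr fun n ↦ eventually_atTop.mpr ⟨n + 1, ?_⟩
  intro m hm
  exact lt_of_lt_of_le (by exact_mod_cast hm) (order_le_of_X_pow_dvd (h m))

variable [TopologicalSpace R]

theorem tendsto_zero_of_X_pow_dvd {f : ℕ → R⟦X⟧} (h : ∀ n, X ^ n ∣ f n) :
    Tendsto f atTop (𝓝 0) := by
  rw [WithPiTopology.tendsto_iff_coeff_tendsto]
  refine fun d => tendsto_const_nhds.congr' ?_
  filter_upwards [eventually_gt_atTop d] with n hn
  rw [X_pow_dvd_iff.1 (h n) d hn, map_zero]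

theorem summable_of_X_pow_dvd {f : ℕ → R⟦X⟧} (h : ∀ n, X ^ n ∣ f n) : Summable f :=
  WithPiTopology.summable_of_tendsto_order_atTop_nhds_top R (tendsto_order_of_X_pow_dvd h)

theorem X_pow_dvd_of_hasSum [T2Space R] {ι : Type*} {f : ι → R⟦X⟧} {a : R⟦X⟧} {d : ℕ}
    (hf : HasSum f a) (h : ∀ i, X ^ d ∣ f i) : X ^ d ∣ a := by
  refine X_pow_dvd_iff.2 fun n hn => ?_
  have h1 := (WithPiTopology.hasSum_iff_hasSum_coeff (R := R)).1 hf n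
  have h2 : (fun i => coeff n (f i)) = fun _ => 0 :=
    funext fun i => X_pow_dvd_iff.1 (h i) n hn
  rw [h2] at h1
  exact h1.unique hasSum_zero

end Convergence

/-! ### The common recurrence of the sum side and the theta side -/

section Recurrence
variable {R : Type*} [CommRing R]

/-- A sequence of power series tending to zero and satisfying the Rogers–Ramanujan recurrence
vanishes. -/
theorem eq_zero_of_recurrence {D : ℕ → R⟦X⟧}
    (hrec : ∀ k, D k = D (k + 1) + X ^ (k + 2) * D (k + 2))
    (hD : ∀ k, X ^ k ∣ D k) (k : ℕ) : D k = 0 := by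
  refine eq_zero_of_forall_X_pow_dvd fun d => ?_
  -- Induction on the distance from `k` up to `d`: the recurrence only refers to larger indices, and
  -- from `d` on `hD` suffices.
  have key : ∀ m k, d ≤ k + m → X ^ d ∣ D k := by
    intro m
    induction m with
    | zero => exact fun k hk => (pow_dvd_pow X hk).trans (hD k)
    | succ m ih =>
      intro k hk
      rw [hrec]
      exact dvd_add (ih _ (by omega)) ((ih _ (by omega)).mul_left _)
  exact key d k (by omega)

variable (R) in
/-- The terms of `∑ q^(n^2 + (k+1)n) / ((1-q)⋯(1-q^n))`. -/
noncomputable def sumSideTerm (k n : ℕ) : R⟦X⟧ :=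
  X ^ (n ^ 2 + (k + 1) * n) * recip (qFactorial X n)

theorem qFactorial_mul_recip (n : ℕ) : qFactorial X n * recip (qFactorial X n) = (1 : R⟦X⟧) :=
  mul_recip _ (constantCoeff_qFactorial (by simp) n)

theorem recip_qFactorial_succ (n : ℕ) :
    (1 - X ^ (n + 1)) * recip (qFactorial X (n + 1)) = recip (qFactorial X n : R⟦X⟧) := by
  have h1 := qFactorial_mul_recip (R := R) n
  have h2 := qFactorial_mul_recip (R := R) (n + 1)
  rw [qFactorial_succ] at h2 ⊢
  linear_combination (recip (qFactorial X n) : R⟦X⟧) * h2 - ((1 - X ^ (n + 1)) *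
    recip (qFactorial X n * (1 - X ^ (n + 1)))) * h1

theorem X_pow_dvd_sumSideTerm (k n : ℕ) : X ^ n ∣ sumSideTerm R k n :=
  (pow_dvd_pow X (by nlinarith)).mul_right _

theorem sumSideTerm_zero (k : ℕ) : sumSideTerm R k 0 = 1 := by
  simpa [sumSideTerm, qFactorial_zero] using mul_recip (1 : R⟦X⟧) (by simp)

/-- The difference of the two powers of `q` contains `1 - q^(n+1)`, which cancels the last factor of
the denominator. -/
theorem sumSideTerm_succ_sub (k n : ℕ) : sumSideTerm R k (n + 1) - sumSideTerm R (k + 1) (n + 1) =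
    X ^ (k + 2) * sumSideTerm R (k + 2) n := by
  simp only [sumSideTerm]
  rw [← recip_qFactorial_succ n]
  ring

variable (R) in
/-- The terms of `∑ (-1)^n q^(2kn + n(5n+3)/2) (1 - q^(k+1+2n)) (1-q^(n+1))⋯(1-q^(n+k))`. -/
noncomputable def thetaSideTerm (k n : ℕ) : R⟦X⟧ :=
  (-1) ^ n * X ^ (2 * k * n + 5 * n.choose 2 + 4 * n) * (1 - X ^ (k + 1 + 2 * n)) *
    ∏ i ∈ range k, (1 - X ^ (n + 1 + i))

theorem X_pow_dvd_thetaSideTerm (k n : ℕ) : X ^ n ∣ thetaSideTerm R k n :=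
  (((pow_dvd_pow X (by nlinarith)).mul_left _).mul_right _).mul_right _

theorem X_pow_dvd_thetaSideTerm_succ (k n : ℕ) : X ^ k ∣ thetaSideTerm R k (n + 1) :=
  (((pow_dvd_pow X (by nlinarith)).mul_left _).mul_right _).mul_right _

theorem thetaSideTerm_zero (k : ℕ) : thetaSideTerm R k 0 = qFactorial X (k + 1) := by
  rw [qFactorial_succ, qFactorial, mul_comm]
  simp [thetaSideTerm, add_comm 1]

theorem thetaSideTerm_zero_left (n : ℕ) : thetaSideTerm R 0 n = thetaTerm R n := by
  simp [thetaSideTerm, thetaTerm, add_comm]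

variable (R) in
/-- The telescoping certificate for the recurrence of the theta side. -/
noncomputable def thetaCertificate (k n : ℕ) : R⟦X⟧ :=
  (-1) ^ n * X ^ (2 * k * n + 5 * n.choose 2 + 4 * n) * (1 - X ^ n) *
    (X ^ (k + 1 + 2 * n) - X ^ n - 1) * ∏ i ∈ range k, (1 - X ^ (n + 1 + i))

theorem thetaCertificate_zero (k : ℕ) : thetaCertificate R k 0 = 0 := by
  simp [thetaCertificate]

theorem X_pow_dvd_thetaCertificate (k n : ℕ) : X ^ n ∣ thetaCertificate R k n :=
  ((((pow_dvd_pow X (by nlinarith)).mul_left _).mul_right _).mul_right _).mul_right _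

/-- The defect of the recurrence telescopes in `n`. The certificate vanishes at `n = 0` and tends to
zero, so the recurrence is exact after summation. -/
theorem thetaSideTerm_sub (k n : ℕ) : thetaSideTerm R k n -
    (thetaSideTerm R (k + 1) n + X ^ (k + 2) * thetaSideTerm R (k + 2) n) =
      thetaCertificate R k (n + 1) - thetaCertificate R k n := by
  -- Passing from `n` to `n + 1` slides the window of `k` factors by one; the factor `1 - X^n` of
  -- the certificate, taken at `n + 1`, supplies the one that is lost.
  have h : (1 - X ^ (n + 1)) * ∏ i ∈ range k, (1 - X ^ (n + 1 + 1 + i) : R⟦X⟧) =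
      (∏ i ∈ range k, (1 - X ^ (n + 1 + i))) * (1 - X ^ (n + 1 + k)) := by
    rw [← prod_range_succ, prod_range_succ', mul_comm]
    simp only [add_zero]
    congr 1
    exact prod_congr rfl fun i _ => by ring
  simp only [thetaSideTerm, thetaCertificate]
  rw [prod_range_succ _ (k + 1), prod_range_succ _ k, Nat.choose_succ_succ' n 1,
    Nat.choose_one_right]
  linear_combination (-((-1) ^ (n + 1) * X ^ (2 * k * (n + 1) + 5 * (n + n.choose 2) + 4 * (n + 1)) *
    (X ^ (k + 1 + 2 * (n + 1)) - X ^ (n + 1) - 1) : R⟦X⟧)) * h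

variable [TopologicalSpace R]

theorem summable_sumSideTerm (k : ℕ) : Summable (sumSideTerm R k) :=
  summable_of_X_pow_dvd (X_pow_dvd_sumSideTerm k)

theorem summable_thetaSideTerm (k : ℕ) : Summable (thetaSideTerm R k) :=
  summable_of_X_pow_dvd (X_pow_dvd_thetaSideTerm k)

variable [IsTopologicalRing R] [T2Space R]

theorem tsum_sumSideTerm_recurrence (k : ℕ) : ∑' n, sumSideTerm R k n =
    ∑' n, sumSideTerm R (k + 1) n + X ^ (k + 2) * ∑' n, sumSideTerm R (k + 2) n := by
  have h0 := (hasSum_nat_add_iff' 1).2 (summable_sumSideTerm (R := R) k).hasSum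
  have h1 := (hasSum_nat_add_iff' 1).2 (summable_sumSideTerm (R := R) (k + 1)).hasSum
  have h2 := (summable_sumSideTerm (R := R) (k + 2)).hasSum.mul_left (X ^ (k + 2))
  have h3 := h0.sub h1
  simp only [sumSideTerm_succ_sub] at h3
  have h4 := h3.unique h2
  simp only [sum_range_one, sumSideTerm_zero] at h4
  linear_combination h4

theorem X_pow_dvd_tsum_sumSideTerm_sub_one (k : ℕ) : X ^ k ∣ ∑' n, sumSideTerm R k n - 1 := by
  have h := summable_sumSideTerm (R := R) k
  rw [h.tsum_eq_zero_add, sumSideTerm_zero, add_sub_cancel_left]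
  refine X_pow_dvd_of_hasSum ((summable_nat_add_iff 1).2 h).hasSum fun n => ?_
  exact (pow_dvd_pow X (by nlinarith)).mul_right _

theorem tsum_thetaSideTerm_recurrence (k : ℕ) : ∑' n, thetaSideTerm R k n =
    ∑' n, thetaSideTerm R (k + 1) n + X ^ (k + 2) * ∑' n, thetaSideTerm R (k + 2) n := by
  have h2 := (summable_thetaSideTerm (R := R) (k + 2)).hasSum.mul_left (X ^ (k + 2))
  have h := (summable_thetaSideTerm (R := R) k).hasSum.sub
    ((summable_thetaSideTerm (R := R) (k + 1)).hasSum.add h2)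
  simp only [thetaSideTerm_sub] at h
  have h3 := h.tendsto_sum_nat
  simp only [sum_range_sub, thetaCertificate_zero, sub_zero] at h3
  exact sub_eq_zero.1 (tendsto_nhds_unique h3
    (tendsto_zero_of_X_pow_dvd (X_pow_dvd_thetaCertificate (R := R) k)))

theorem X_pow_dvd_tsum_thetaSideTerm_sub (k : ℕ) :
    X ^ k ∣ ∑' n, thetaSideTerm R k n - qFactorial X (k + 1) := by
  have h := summable_thetaSideTerm (R := R) k
  rw [h.tsum_eq_zero_add, thetaSideTerm_zero, add_sub_cancel_left]
  exact X_pow_dvd_of_hasSum ((summable_nat_add_iff 1).2 h).hasSum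
    fun n => X_pow_dvd_thetaSideTerm_succ k n

/-- If `φ = (q; q)_∞`, then `φ * ∑ q^(n^2 + n) / (q; q)_n` is the theta series. -/
theorem mul_tsum_sumSideTerm {φ : R⟦X⟧} (hφ : ∀ k, X ^ k ∣ φ - qFactorial X k) :
    φ * ∑' n, sumSideTerm R 0 n = ∑' n, thetaTerm R n := by
  rw [← sub_eq_zero]
  simp only [← thetaSideTerm_zero_left]
  -- Modulo `X ^ k` both members of the difference are congruent to `φ`.
  refine eq_zero_of_recurrence
    (D := fun k => φ * ∑' n, sumSideTerm R k n - ∑' n, thetaSideTerm R k n) ?_ ?_ 0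
  · intro k
    rw [tsum_sumSideTerm_recurrence k, tsum_thetaSideTerm_recurrence k]
    ring
  · intro k
    have h1 := (X_pow_dvd_tsum_sumSideTerm_sub_one (R := R) k).mul_left φ
    have h2 := X_pow_dvd_tsum_thetaSideTerm_sub (R := R) k
    have h3 := (pow_dvd_pow X k.le_succ).trans (hφ (k + 1))
    have : φ * ∑' n, sumSideTerm R k n - ∑' n, thetaSideTerm R k n =
        φ * (∑' n, sumSideTerm R k n - 1) + (φ - qFactorial X (k + 1)) -
          (∑' n, thetaSideTerm R k n - qFactorial X (k + 1)) := by ring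
    rw [this]
    exact dvd_sub (dvd_add h1 h3) h2

end Recurrence

/-! ### The second Rogers–Ramanujan identity -/

section Product
variable {R : Type*} [CommRing R]

theorem prod_range_five_mul {M : Type*} [CommMonoid M] (f : ℕ → M) (N : ℕ) :
    ∏ i ∈ range (5 * N), f i = ∏ i ∈ range N,
      (f (5 * i) * f (5 * i + 1) * f (5 * i + 2) * f (5 * i + 3) * f (5 * i + 4)) := by
  induction N with
  | zero => simp
  | succ N ih =>
    rw [prod_range_succ, ← ih, Nat.mul_succ]
    simp only [prod_range_succ, mul_assoc]

theorem weight_of_notMem (t w v x : R) {k : ℕ} (hk : k ∉ ({2, 3, 7, 8} : Finset ℕ)) :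
    weight t w v x k = 1 := by
  simp only [mem_insert, mem_singleton, not_or] at hk
  simp [weight, hk]

theorem factor_of_notMem (t w v x : R) {k : ℕ} (hk : k ∉ ({2, 3, 7, 8} : Finset ℕ)) :
    factor t w v x k = 1 - X ^ k := by
  simp [factor, weight_of_notMem t w v x hk]

theorem Part23.ne_zero (k : Part23) : (k : ℕ) ≠ 0 := by
  have := k.2; omega

theorem dvd_recip_sub_one {f g : R⟦X⟧} (hf : constantCoeff f = 1) (h : g ∣ f - 1) :
    g ∣ recip f - 1 := by
  have : recip f - 1 = -(f - 1) * recip f := by linear_combination mul_recip f hf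
  rw [this]
  exact (h.neg_right).mul_right _

variable [TopologicalSpace R]

theorem multipliable_part23 {f : Part23 → R⟦X⟧} (hf : ∀ k : Part23, X ^ (k : ℕ) ∣ f k - 1) :
    Multipliable f := by
  have : Nonempty Part23 := ⟨⟨2, Or.inl rfl⟩⟩
  have h : Multipliable fun k : Part23 => 1 + (f k - 1) := by
    refine WithPiTopology.multipliable_one_add_of_tendsto_order_atTop_nhds_top R ?_
    -- The threshold `5 * n + 2` is a number above `n` that lies in `Part23`.
    refine ENat.tendsto_nhds_top_iff_natCast_lt.mpr fun n => 
      eventually_atTop.mpr ⟨⟨5 * n + 2, by omega⟩, ?_⟩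
    intro m hm
    have hm' : 5 * n + 2 ≤ (m : ℕ) := hm
    refine lt_of_lt_of_le ?_ (order_le_of_X_pow_dvd (hf m))
    exact_mod_cast (by omega : n < (m : ℕ))
  simpa using h

theorem X_pow_dvd_sub_of_tendsto [T2Space R] {f : ℕ → R⟦X⟧} {a c : R⟦X⟧} {d : ℕ}
    (hf : Tendsto f atTop (𝓝 a)) (h : ∀ n, d ≤ n → X ^ d ∣ f n - c) : X ^ d ∣ a - c := by
  refine X_pow_dvd_iff.2 fun m hm => ?_
  have h1 := (WithPiTopology.tendsto_iff_coeff_tendsto R f atTop a).1 hf m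
  have h2 : Tendsto (fun n => coeff m (f n)) atTop (𝓝 (coeff m c)) := by
    refine tendsto_const_nhds.congr' ?_
    filter_upwards [eventually_ge_atTop d] with n hn
    have := X_pow_dvd_iff.1 (h n hn) m hm
    rw [map_sub, sub_eq_zero] at this
    exact this.symm
  rw [map_sub, sub_eq_zero]
  exact tendsto_nhds_unique h1 h2

variable (R) in
theorem tendsto_qFactorial :
    Tendsto (qFactorial (X : R⟦X⟧)) atTop (𝓝 (∏' i, (1 - X ^ (i + 1)))) :=
  (WithPiTopology.multipliable_one_sub_X_pow R).hasProd.tendsto_prod_nat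

variable (R) in
theorem X_pow_dvd_tprod_sub_qFactorial [T2Space R] (k : ℕ) :
    X ^ k ∣ ∏' i, (1 - X ^ (i + 1) : R⟦X⟧) - qFactorial X k :=
  X_pow_dvd_sub_of_tendsto (tendsto_qFactorial R) fun n hn =>
    pow_dvd_qFactorial_sub X (by omega) (by omega)

variable [IsTopologicalRing R]

variable (R) in
theorem tendsto_triple_product :
    Tendsto (fun N => (∏ i ∈ range N, ((1 - X ^ (5 * i + 1)) * (1 - X ^ (5 * i + 4)) : R⟦X⟧)) *
      qFactorial (X ^ 5) N) atTop (𝓝 (∑' n, thetaTerm R n)) := by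
  have h1 := tendsto_zero_of_X_pow_dvd (X_pow_dvd_triple_product_sub (R := R))
  have hs : Summable (thetaTerm R) := by
    rw [← funext thetaSideTerm_zero_left]
    exact summable_thetaSideTerm 0
  simpa using h1.add hs.hasSum.tendsto_sum_nat

variable (R) in
/-- The second Rogers–Ramanujan identity. -/
theorem tsum_mul_tprod_part23 [T2Space R] :
    (∑' n, sumSideTerm R 0 n) * ∏' k : Part23, (1 - X ^ (k : ℕ) : R⟦X⟧) = 1 := by
  set φ : R⟦X⟧ := ∏' i, (1 - X ^ (i + 1)) with hφ
  have hφ1 := mul_tsum_sumSideTerm (X_pow_dvd_tprod_sub_qFactorial R)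
  have hu : IsUnit φ := by
    refine isUnit_of_constantCoeff_eq_one ?_
    have h := X_pow_dvd_iff.1 (X_pow_dvd_tprod_sub_qFactorial R 1) 0 one_pos
    rwa [coeff_zero_eq_constantCoeff_apply, map_sub, constantCoeff_qFactorial (by simp),
      sub_eq_zero] at h
  have hB : HasProd (fun k : Part23 => (1 - X ^ (k : ℕ) : R⟦X⟧)) _ :=
    (multipliable_part23 fun k => by simp [← dvd_neg]).hasProd
  set B : R⟦X⟧ := ∏' k : Part23, (1 - X ^ (k : ℕ))
  have hB1 : HasProd (Set.mulIndicator {k : ℕ | k % 5 = 2 ∨ k % 5 = 3}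
      fun k => (1 - X ^ k : R⟦X⟧)) B :=
    hasProd_subtype_iff_mulIndicator.1 hB
  have hmul : Tendsto (fun N : ℕ => 5 * N) atTop atTop :=
    tendsto_id.const_mul_atTop' (by norm_num)
  have hB2 := hB1.tendsto_prod_nat.comp hmul
  have h := (tendsto_triple_product R).mul hB2
  have hlim := (tendsto_qFactorial R).comp hmul
  -- The factors of `(q;q)_(5N)` are sorted by residue modulo `5`: `1` and `4`, then `0`, then `2`
  -- and `3`. The indicator also discards the index `0`, where `1 - X^0` would vanish.
  have hfun : ∀ N, (∏ i ∈ range N, ((1 - X ^ (5 * i + 1)) * (1 - X ^ (5 * i + 4)) : R⟦X⟧)) *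
      qFactorial (X ^ 5) N * ∏ i ∈ range (5 * N), Set.mulIndicator
        {k : ℕ | k % 5 = 2 ∨ k % 5 = 3} (fun k => (1 - X ^ k : R⟦X⟧)) i =
      qFactorial X (5 * N) := by
    intro N
    rw [prod_range_five_mul, qFactorial, qFactorial, prod_range_five_mul, ← prod_mul_distrib,
      ← prod_mul_distrib]
    refine prod_congr rfl fun i _ => ?_
    have e0 : 5 * i % 5 = 0 := by omega
    have e1 : (5 * i + 1) % 5 = 1 := by omega
    have e2 : (5 * i + 2) % 5 = 2 := by omega
    have e3 : (5 * i + 3) % 5 = 3 := by omega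
    have e4 : (5 * i + 4) % 5 = 4 := by omega
    simp only [Set.mulIndicator, Set.mem_ofPred_eq, e0, e1, e2, e3, e4]
    norm_num
    ring
  have heq : (∑' n, thetaTerm R n) * B = φ := by
    refine tendsto_nhds_unique h ?_
    simpa only [Function.comp_def, hfun] using hlim
  rw [← hφ1] at heq
  refine hu.mul_left_cancel ?_
  rw [← mul_assoc, heq, mul_one]

end Product

/-! ### Insertion of the weights -/

section Weighted
variable {R : Type*} [CommRing R] (t w v x : R)

/-- The product of the weighted factors for the part sizes `2, 3, 7, 8`. -/
noncomputable def weightedProd : R⟦X⟧ := ∏ k ∈ ({2, 3, 7, 8} : Finset ℕ), factor t w v x k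

/-- The ratio of the unweighted to the weighted factors for the part sizes `2, 3, 7, 8`. -/
noncomputable def weightRatio : R⟦X⟧ :=
  (∏ k ∈ ({2, 3, 7, 8} : Finset ℕ), (1 - X ^ k)) * recip (weightedProd t w v x)

theorem constantCoeff_weightedProd : constantCoeff (weightedProd t w v x) = 1 := by
  rw [weightedProd, map_prod]
  refine prod_eq_one fun k hk => constantCoeff_factor t w v x ?_
  rintro rfl
  simp at hk

theorem weightedProd_mul_weightRatio : weightedProd t w v x * weightRatio t w v x =
    ∏ k ∈ ({2, 3, 7, 8} : Finset ℕ), (1 - X ^ k) := by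
  rw [weightRatio]
  linear_combination (∏ k ∈ ({2, 3, 7, 8} : Finset ℕ), (1 - X ^ k : R⟦X⟧)) *
    mul_recip _ (constantCoeff_weightedProd t w v x)

theorem factor_two : factor t w v x 2 = 1 - C t * X ^ 2 := by simp [factor, weight]
theorem factor_three : factor t w v x 3 = 1 - C w * X ^ 3 := by simp [factor, weight]
theorem factor_seven : factor t w v x 7 = 1 - C v * X ^ 7 := by simp [factor, weight]
theorem factor_eight : factor t w v x 8 = 1 - C x * X ^ 8 := by simp [factor, weight]

theorem X_pow_dvd_factor_sub_one (k : ℕ) : X ^ k ∣ factor t w v x k - 1 := by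
  simp only [factor, sub_sub_cancel_left, dvd_neg]
  exact dvd_mul_left _ _

theorem denominator_mul_sumTerm (m : ℕ) : denominator t w v x m * sumTerm t w v x m =
    X ^ (m * (m + 1)) * (numerator t w v x m : R⟦X⟧) := by
  rw [sumTerm]
  linear_combination (X ^ (m * (m + 1)) * (numerator t w v x m : R⟦X⟧)) *
    mul_recip _ (constantCoeff_denominator t w v x m)

theorem qFactorial_mul_sumSideTerm (m : ℕ) :
    qFactorial X m * sumSideTerm R 0 m = X ^ (m * (m + 1)) := by
  rw [sumSideTerm, show m ^ 2 + (0 + 1) * m = m * (m + 1) by ring]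
  linear_combination (X ^ (m * (m + 1)) : R⟦X⟧) * qFactorial_mul_recip (R := R) m

theorem prod_Icc_one_sub_X_pow (m : ℕ) :
    ∏ k ∈ Icc 1 m, (1 - X ^ k : R⟦X⟧) = qFactorial X m := by
  induction m with
  | zero => simp [qFactorial]
  | succ m ih => rw [prod_Icc_succ_top (by omega), ih, qFactorial_succ]

/-- A term of the sum side is a multiple of the unweighted term as soon as this holds after
clearing denominators. -/
theorem sumTerm_eq_of_mul_eq {m : ℕ}
    (h : weightedProd t w v x * qFactorial X m * (numerator t w v x m : R⟦X⟧) =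
      denominator t w v x m * ∏ k ∈ ({2, 3, 7, 8} : Finset ℕ), (1 - X ^ k)) :
    sumTerm t w v x m = weightRatio t w v x * sumSideTerm R 0 m := by
  have hw := isUnit_of_constantCoeff_eq_one (constantCoeff_weightedProd t w v x)
  have hq := isUnit_of_constantCoeff_eq_one
    (constantCoeff_qFactorial (Q := (X : R⟦X⟧)) (by simp) m)
  have hd := isUnit_of_constantCoeff_eq_one (constantCoeff_denominator t w v x m)
  refine ((hw.mul hq).mul hd).mul_left_cancel ?_
  linear_combination (weightedProd t w v x * qFactorial X m) * denominator_mul_sumTerm t w v x m +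
    X ^ (m * (m + 1)) * h - denominator t w v x m * weightedProd t w v x * weightRatio t w v x *
      qFactorial_mul_sumSideTerm (R := R) m -
    X ^ (m * (m + 1)) * denominator t w v x m * weightedProd_mul_weightRatio t w v x

/-- All four weighted sizes occur in the denominator, so the ratio merely exchanges these four
factors. -/
theorem sumTerm_add_eight (m : ℕ) :
    sumTerm t w v x (m + 8) = weightRatio t w v x * sumSideTerm R 0 (m + 8) := by
  refine sumTerm_eq_of_mul_eq t w v x ?_
  have hs : ({2, 3, 7, 8} : Finset ℕ) ⊆ Icc 1 (m + 8) := by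
    intro k hk
    simp only [mem_insert, mem_singleton] at hk
    rw [mem_Icc]
    omega
  have hd : denominator t w v x (m + 8) = ∏ k ∈ Icc 1 (m + 8), factor t w v x k := rfl
  have hn : numerator t w v x (m + 8) = 1 := rfl
  rw [hd, hn, ← prod_Icc_one_sub_X_pow, weightedProd, ← prod_sdiff hs,
    ← prod_sdiff (f := factor t w v x) hs,
    prod_congr rfl fun k hk => factor_of_notMem t w v x (Finset.mem_sdiff.1 hk).2]
  simp only [Polynomial.coe_one]
  ring

/-- The numerator is what remains of `(1-q^2)(1-q^3)(1-q^7)(1-q^8)` over `(q;q)_5`, namely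
`(1-q^7)(1-q^8)/((1-q)(1-q^4))`, with `1-q^5` left below. The cases `6` and `7` are analogous. -/
theorem sumTerm_five : sumTerm t w v x 5 = weightRatio t w v x * sumSideTerm R 0 5 := by
  refine sumTerm_eq_of_mul_eq t w v x ?_
  simp [weightedProd, denominator, denominatorParts, numerator, qFactorial, prod_range_succ,
    factor, weight]
  ring

theorem sumTerm_six : sumTerm t w v x 6 = weightRatio t w v x * sumSideTerm R 0 6 := by
  refine sumTerm_eq_of_mul_eq t w v x ?_
  simp [weightedProd, denominator, denominatorParts, numerator, qFactorial, prod_range_succ,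
    factor, weight]
  ring

theorem sumTerm_seven : sumTerm t w v x 7 = weightRatio t w v x * sumSideTerm R 0 7 := by
  refine sumTerm_eq_of_mul_eq t w v x ?_
  simp [weightedProd, denominator, denominatorParts, numerator, qFactorial, prod_range_succ,
    factor, weight]
  ring

theorem weightedProd_mul_sumTerm {m : ℕ} {r : R⟦X⟧}
    (h : weightedProd t w v x = denominator t w v x m * r) :
    weightedProd t w v x * sumTerm t w v x m =
      X ^ (m * (m + 1)) * (numerator t w v x m : R⟦X⟧) * r := by
  rw [h]
  linear_combination r * denominator_mul_sumTerm t w v x m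

theorem mul_sumSideTerm_of_eq {m : ℕ} {p r : R⟦X⟧} (h : p = qFactorial X m * r) :
    p * sumSideTerm R 0 m = X ^ (m * (m + 1)) * r := by
  rw [h]
  linear_combination r * qFactorial_mul_sumSideTerm (R := R) m

theorem prod_one_sub_X_pow_parts : ∏ k ∈ ({2, 3, 7, 8} : Finset ℕ), (1 - X ^ k : R⟦X⟧) =
    (1 - X ^ 2) * (1 - X ^ 3) * (1 - X ^ 7) * (1 - X ^ 8) := by
  simp
  ring

theorem weightedProd_eq : weightedProd t w v x =
    factor t w v x 2 * factor t w v x 3 * factor t w v x 7 * factor t w v x 8 := by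
  simp [weightedProd]
  ring

/-- Both sides become polynomials after multiplication by `weightedProd`, since `(q;q)_m` divides
`(1-q^2)(1-q^3)(1-q^7)(1-q^8)` for `m ≤ 4`. The right side is then free of weights, so the weights
on the left cancel between the terms. -/
theorem sum_sumTerm_range_five : ∑ m ∈ range 5, sumTerm t w v x m =
    ∑ m ∈ range 5, weightRatio t w v x * sumSideTerm R 0 m := by
  have hw := isUnit_of_constantCoeff_eq_one (constantCoeff_weightedProd t w v x)
  refine hw.mul_left_cancel ?_
  have hP := prod_one_sub_X_pow_parts (R := R)
  have hW := weightedProd_eq t w v x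
  have l0 := weightedProd_mul_sumTerm t w v x (m := 0)
    (r := factor t w v x 2 * factor t w v x 3 * factor t w v x 7 * factor t w v x 8)
    (by rw [hW]; simp [denominator, denominatorParts])
  have l1 := weightedProd_mul_sumTerm t w v x (m := 1)
    (r := factor t w v x 3 * factor t w v x 7 * factor t w v x 8)
    (by rw [hW]; simp [denominator, denominatorParts]; ring)
  have l2 := weightedProd_mul_sumTerm t w v x (m := 2)
    (r := factor t w v x 7 * factor t w v x 8)
    (by rw [hW]; simp [denominator, denominatorParts]; ring)
  have l3 := weightedProd_mul_sumTerm t w v x (m := 3) (r := factor t w v x 8)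
    (by rw [hW]; simp [denominator, denominatorParts]; ring)
  have l4 := weightedProd_mul_sumTerm t w v x (m := 4) (r := 1)
    (by rw [hW]; simp [denominator, denominatorParts]; ring)
  have r0 := mul_sumSideTerm_of_eq (m := 0)
    (r := (1 - X ^ 2) * (1 - X ^ 3) * (1 - X ^ 7) * (1 - X ^ 8 : R⟦X⟧)) (hP.trans (by
      simp [qFactorial]))
  have r1 := mul_sumSideTerm_of_eq (m := 1)
    (r := (1 + X) * (1 - X ^ 3) * (1 - X ^ 7) * (1 - X ^ 8 : R⟦X⟧)) (hP.trans (by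
      simp [qFactorial]; ring))
  have r2 := mul_sumSideTerm_of_eq (m := 2)
    (r := (1 + X + X ^ 2) * (1 - X ^ 7) * (1 - X ^ 8 : R⟦X⟧)) (hP.trans (by
      simp [qFactorial, prod_range_succ]; ring))
  have r3 := mul_sumSideTerm_of_eq (m := 3)
    (r := (1 + X + X ^ 2 + X ^ 3 + X ^ 4 + X ^ 5 + X ^ 6) * (1 - X ^ 8 : R⟦X⟧)) (hP.trans (by
      simp [qFactorial, prod_range_succ]; ring))
  have r4 := mul_sumSideTerm_of_eq (m := 4)
    (r := (1 + X + X ^ 2 + X ^ 3 + X ^ 4 + X ^ 5 + X ^ 6) * (1 + X ^ 4 : R⟦X⟧)) (hP.trans (by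
      simp [qFactorial, prod_range_succ]; ring))
  rw [← mul_sum, ← mul_assoc, weightedProd_mul_weightRatio, mul_sum, mul_sum]
  simp only [sum_range_succ, sum_range_zero, l0, l1, l2, l3, l4, r0, r1, r2, r3, r4]
  simp [numerator, factor_two, factor_three, factor_seven, factor_eight]
  ring

theorem sumTerm_add_five (m : ℕ) :
    sumTerm t w v x (m + 5) = weightRatio t w v x * sumSideTerm R 0 (m + 5) := by
  match m with
  | 0 => exact sumTerm_five t w v x
  | 1 => exact sumTerm_six t w v x
  | 2 => exact sumTerm_seven t w v x
  | m + 3 => exact sumTerm_add_eight t w v x m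

variable [TopologicalSpace R]

theorem multipliable_recip_factor :
    Multipliable fun k : Part23 => recip (factor t w v x k) :=
  multipliable_part23 fun k => dvd_recip_sub_one (constantCoeff_factor t w v x k.ne_zero)
    (X_pow_dvd_factor_sub_one t w v x k)

variable [IsTopologicalRing R]

theorem hasSum_sumTerm :
    HasSum (sumTerm t w v x) (weightRatio t w v x * ∑' n, sumSideTerm R 0 n) := by
  have h := (summable_sumSideTerm (R := R) 0).hasSum.mul_left (weightRatio t w v x)
  rw [← hasSum_nat_add_iff' 5] at h ⊢
  rw [sum_sumTerm_range_five]
  simpa only [sumTerm_add_five] using h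

variable [T2Space R]

/-- The part sizes congruent to `2` or `3` modulo `5` that carry a weight. -/
def weightedParts : Finset Part23 :=
  {⟨2, .inl rfl⟩, ⟨3, .inr rfl⟩, ⟨7, .inl rfl⟩, ⟨8, .inr rfl⟩}

/-- The two infinite products differ in four factors only, so their quotient is a finite product;
cross-multiplication avoids stating it as a quotient. -/
theorem tprod_part23_mul_weightedProd :
    (∏' k : Part23, (1 - X ^ (k : ℕ) : R⟦X⟧)) * weightedProd t w v x =
      (∏' k : Part23, factor t w v x k) * ∏ k ∈ ({2, 3, 7, 8} : Finset ℕ), (1 - X ^ k) := by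
  have hB : HasProd (fun k : Part23 => (1 - X ^ (k : ℕ) : R⟦X⟧)) _ :=
    (multipliable_part23 fun k => by simp [← dvd_neg]).hasProd
  have he := hasProd_prod_of_ne_finset_one (s := weightedParts) (L := .unconditional _)
    (f := fun k : Part23 => factor t w v x k * recip (1 - X ^ (k : ℕ) : R⟦X⟧)) (by
      intro k hk
      rw [factor_of_notMem, mul_recip _ (constantCoeff_one_sub_X_pow (R := R) k.ne_zero)]
      contrapose! hk
      simpa [weightedParts, Subtype.ext_iff] using hk)
  have h := (hB.mul he).tprod_eq
  have hk : ∀ k : Part23, (1 - X ^ (k : ℕ)) * (factor t w v x k * recip (1 - X ^ (k : ℕ) : R⟦X⟧)) =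
      factor t w v x k := fun k => by
    linear_combination factor t w v x k * mul_recip _ (constantCoeff_one_sub_X_pow (R := R) k.ne_zero)
  simp only [hk] at h
  rw [h, mul_assoc]
  congr 1
  have e : ∀ n : ℕ, n ≠ 0 → recip (1 - X ^ n : R⟦X⟧) * (1 - X ^ n) = 1 := fun n hn => by
    rw [mul_comm, mul_recip _ (constantCoeff_one_sub_X_pow hn)]
  have hs : ∏ k ∈ weightedParts, factor t w v x k * recip (1 - X ^ (k : ℕ) : R⟦X⟧) =
      ∏ k ∈ ({2, 3, 7, 8} : Finset ℕ), factor t w v x k * recip (1 - X ^ k) := by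
    simp [weightedParts, Subtype.ext_iff]
  rw [hs, ← prod_mul_distrib, weightedProd]
  refine prod_congr rfl fun k hk => ?_
  rw [mul_assoc, e k (by rintro rfl; simp at hk), mul_one]

theorem weighted_rogers_ramanujan :
    ∑' m, sumTerm t w v x m = ∏' k : Part23, recip (factor t w v x k) := by
  have hF := multipliable_part23 fun k : Part23 => X_pow_dvd_factor_sub_one t w v x (k : ℕ)
  have h1 := (hF.hasProd.mul (multipliable_recip_factor t w v x).hasProd).tprod_eq
  have hk : ∀ k : Part23, factor t w v x k * recip (factor t w v x k) = 1 :=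
    fun k => mul_recip _ (constantCoeff_factor t w v x k.ne_zero)
  simp only [hk, tprod_one] at h1
  have h2 := tprod_part23_mul_weightedProd t w v x
  have h3 := tsum_mul_tprod_part23 R
  have h4 := weightedProd_mul_weightRatio t w v x
  have hw := isUnit_of_constantCoeff_eq_one (constantCoeff_weightedProd t w v x)
  rw [(hasSum_sumTerm t w v x).tsum_eq]
  refine hw.mul_left_cancel ?_
  set G := ∑' n, sumSideTerm R 0 n
  set P : R⟦X⟧ := ∏ k ∈ ({2, 3, 7, 8} : Finset ℕ), (1 - X ^ k)
  set S := ∏' k : Part23, recip (factor t w v x k)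
  -- With `W` the weighted product, `B` the unweighted and `F` the weighted infinite product, the
  -- relations are `F S = 1`, `B W = F P`, `G B = 1`; hence `W S = G B W S = G F P S = G P`.
  linear_combination G * h4 + G * P * h1 - G * S * h2 + weightedProd t w v x * S * h3

end Weighted

/-! ### Nonnegativity of the numerators -/

section Nonneg

/-- A predicate for polynomials over `ℤ[t, w, v, x]` with nonnegative coefficients. -/
def CoeffNonneg (p : Polynomial (MvPolynomial (Fin 4) ℤ)) : Prop :=
  ∀ n d, 0 ≤ (p.coeff n).coeff d

namespace CoeffNonneg
variable {p r : Polynomial (MvPolynomial (Fin 4) ℤ)}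

theorem add (hp : CoeffNonneg p) (hr : CoeffNonneg r) : CoeffNonneg (p + r) := fun n d => by
  rw [Polynomial.coeff_add, MvPolynomial.coeff_add]
  exact add_nonneg (hp n d) (hr n d)

theorem mul (hp : CoeffNonneg p) (hr : CoeffNonneg r) : CoeffNonneg (p * r) := fun n d => by
  rw [Polynomial.coeff_mul, MvPolynomial.coeff_sum]
  refine sum_nonneg fun i _ => ?_
  rw [MvPolynomial.coeff_mul]
  exact sum_nonneg fun j _ => mul_nonneg (hp _ _) (hr _ _)

theorem C_of_nonneg {a : MvPolynomial (Fin 4) ℤ} (h : ∀ d, 0 ≤ a.coeff d) :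
    CoeffNonneg (Polynomial.C a) := fun n d => by
  rw [Polynomial.coeff_C]
  split_ifs
  exacts [h d, by simp]

theorem C_X (i : Fin 4) : CoeffNonneg (Polynomial.C (MvPolynomial.X i)) :=
  C_of_nonneg fun d => by classical rw [MvPolynomial.coeff_X]; split_ifs <;> simp

theorem one : CoeffNonneg 1 := by
  rw [← Polynomial.C_1]
  exact C_of_nonneg fun d => by classical rw [MvPolynomial.coeff_one]; split_ifs <;> simp

theorem X : CoeffNonneg Polynomial.X := fun n d => by
  classical
  rw [Polynomial.coeff_X]
  split_ifs
  · rw [MvPolynomial.coeff_one]; split_ifs <;> simp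
  · simp

theorem pow (hp : CoeffNonneg p) (n : ℕ) : CoeffNonneg (p ^ n) := by
  induction n with
  | zero => rw [pow_zero]; exact one
  | succ n ih => rw [pow_succ]; exact ih.mul hp

end CoeffNonneg

/-- The numerators are written without subtraction, from `1`, the variable `q` and the four weights,
so closure under sums, products and powers suffices. -/
theorem numerator_coeffNonneg (m : ℕ) : CoeffNonneg (numerator (MvPolynomial.X 0 :
    MvPolynomial (Fin 4) ℤ) (MvPolynomial.X 1) (MvPolynomial.X 2) (MvPolynomial.X 3) m) := by
  unfold numerator
  split
  all_goals
    try simp only [Polynomial.C_add, Polynomial.C_mul, Polynomial.C_pow, Polynomial.C_1]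
    repeat' first
      | with_reducible exact CoeffNonneg.one
      | with_reducible exact CoeffNonneg.X
      | with_reducible exact CoeffNonneg.C_X _
      | with_reducible apply CoeffNonneg.add
      | with_reducible apply CoeffNonneg.mul
      | with_reducible apply CoeffNonneg.pow

end Nonneg
end RogersRamanujan

/-- With the discrete topology on `R`, convergence in the product topology means that each
coefficient is eventually constant, which is coefficientwise convergence of formal power series. -/
theorem mainTheorem1 :
    (∀ (R : Type*) [CommRing R] [TopologicalSpace R] [DiscreteTopology R] (t w v x : R),
      Summable (fun m : ℕ => RogersRamanujan.sumTerm t w v x m) ∧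
      Multipliable (fun k : RogersRamanujan.Part23 =>
        RogersRamanujan.recip (RogersRamanujan.factor t w v x k)) ∧
      ∑' m : ℕ, RogersRamanujan.sumTerm t w v x m =
        ∏' k : RogersRamanujan.Part23,
          RogersRamanujan.recip (RogersRamanujan.factor t w v x k)) ∧
    (∀ (m n : ℕ) (d : Fin 4 →₀ ℕ),
      0 ≤ MvPolynomial.coeff d
        ((RogersRamanujan.numerator (MvPolynomial.X 0 : MvPolynomial (Fin 4) ℤ)
          (MvPolynomial.X 1) (MvPolynomial.X 2) (MvPolynomial.X 3) m).coeff n)) := by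
  refine ⟨fun R _ _ _ t w v x => ?_, fun m n d => ?_⟩
  · exact ⟨(RogersRamanujan.hasSum_sumTerm t w v x).summable,
      RogersRamanujan.multipliable_recip_factor t w v x,
      RogersRamanujan.weighted_rogers_ramanujan t w v x⟩
  · exact RogersRamanujan.numerator_coeffNonneg m n d
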